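/- **Lemma (core).** Let $X\subset\mathbb R^2$ be a smooth simple closed curve that bounds a compact convex body, parametrized by arclength, with unit tangent $T(s)$, unit normal $N(s)$ such that $(T,N)$ is positively oriented, and signed curvature $\kappa(s)\neq 0$ for all $s$ (no flat points). Let $C=\{X(s)+\kappa(s)^{-1}N(s)\}$ be its caustic (the set of curvature centres). For $Q\in\mathbb R^2$ let $n(Q)$ be the number of normals to $X$ emerging from $Q$, that is, the number of points $P\in X$ such that the normal line to $X$ at $P$ contains $Q$. Call the connected components of $\mathbb R^2\setminus C$ the domains of the caustic, their closures the closed domains, and let the core of the caustic be the union of the closures of those domains all of whose points have at least four emerging normals. Orient the closed path $s\mapsto X(s)+\kappa(s)^{-1}N(s)$ (that is, traverse it in the direction of increasing or of decreasing $s$) so that it is compatible with its co-orientation: at every $s$ with $\kappa'(s)\ne0$ (a fold point of the caustic), the points near the caustic on the left of the oriented caustic have exactly two normals with foot near $X(s)$, and the points on the right have none. For $Q\notin C$ let $i(Q)\in\mathbb Z$ be the winding number of the oriented caustic around $Q$. Then such an orientation exists, and for every such orientation: 1. for every $Q\notin C$, the number $n(Q)$ is finite and $n(Q)=2\,i(Q)+2$;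 2. the core of the caustic and the set $\{Q\notin C: i(Q)\neq0\}$ have the same closure; and if the caustic divides the plane into finitely many domains, then the core is equal to the closure of $\{Q\notin C: i(Q)\ne 0\}$. -/

import Mathlib

open Set Filter Topology
open scoped ContDiff

noncomputable section

namespace PlaneCaustic

/-- `γ` is the arclength parametrization, with period `L`, of a smooth simple closed curve in the
Euclidean plane `ℂ`. -/
structure IsSmoothClosedCurve (γ : ℝ → ℂ) (L : ℝ) : Prop where
  pos : 0 < L
  smooth : ContDiff ℝ ∞ γ
  periodic : Function.Periodic γ L
  unit_speed : ∀ s, ‖deriv γ s‖ = 1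
  simple : InjOn γ (Ico 0 L)

/-- A convex curve: a smooth simple closed curve that is the boundary of a convex body. -/
structure IsConvexCurve (γ : ℝ → ℂ) (L : ℝ) : Prop extends IsSmoothClosedCurve γ L where
  convex : ∃ K : Set ℂ,
    Convex ℝ K ∧ IsCompact K ∧ (interior K).Nonempty ∧ range γ = frontier K

/-- The unit tangent vector `T(s)`. -/
def tangent (γ : ℝ → ℂ) (s : ℝ) : ℂ := deriv γ s

/-- The unit normal vector `N(s)`; the pair `T(s), N(s)` is positively oriented. -/
def normal (γ : ℝ → ℂ) (s : ℝ) : ℂ := Complex.I * tangent γ s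

/-- The signed curvature `κ(s)`, that is, `T'(s) = κ(s) N(s)`. -/
def curvature (γ : ℝ → ℂ) (s : ℝ) : ℝ := inner ℝ (deriv (tangent γ) s) (normal γ s)

/-- The centre of curvature of the curve at the point with parameter `s` (where `κ(s) ≠ 0`). -/
def center (γ : ℝ → ℂ) (s : ℝ) : ℂ := γ s + ((curvature γ s)⁻¹ : ℝ) * normal γ s

/-- The caustic: the set of all centres of curvature. -/
def caustic (γ : ℝ → ℂ) : Set ℂ := range (center γ)

/-- The normal line to the curve at the parameter `s` passes through `Q`. -/
def NormalThrough (γ : ℝ → ℂ) (Q : ℂ) (s : ℝ) : Prop := inner ℝ (Q - γ s) (tangent γ s) = 0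

/-- The points `P` of the curve such that the normal at `P` contains `Q`: the number `n(Q)` of
normals emerging from `Q` is the number of these points. -/
def normalFeet (γ : ℝ → ℂ) (Q : ℂ) : Set ℂ := {P | ∃ s, γ s = P ∧ NormalThrough γ Q s}

/-- The number `n(Q)` of normals emerging from `Q`, possibly infinite. -/
def numNormals (γ : ℝ → ℂ) (Q : ℂ) : ℕ∞ := (normalFeet γ Q).encard

/-- The (open) domains into which the caustic divides the plane. -/
def domains (γ : ℝ → ℂ) : Set (Set ℂ) :=
  {U | ∃ Q ∈ (caustic γ)ᶜ, U = connectedComponentIn (caustic γ)ᶜ Q}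

/-- The core of the caustic: the union of the closed domains whose (interior) points have at
least four emerging normals. -/
def core (γ : ℝ → ℂ) : Set ℂ :=
  ⋃ U ∈ {U | U ∈ domains γ ∧ ∀ Q ∈ U, 4 ≤ numNormals γ Q}, closure U

/-- The caustic as a closed path, traversed in the direction given by the sign `ε`. -/
def orientedCaustic (γ : ℝ → ℂ) (ε : ℤˣ) (s : ℝ) : ℂ := center γ (((ε : ℤ) : ℝ) * s)

/-- The velocity vector of the oriented caustic at the centre of curvature `center γ s`. -/
def causticVelocity (γ : ℝ → ℂ) (ε : ℤˣ) (s : ℝ) : ℂ := ((ε : ℤ) : ℂ) * deriv (center γ) s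

/-- The parameters within distance `r` of `s` of the normals through `Q`. -/
def normalsNear (γ : ℝ → ℂ) (Q : ℂ) (s r : ℝ) : Set ℝ :=
  {t | t ∈ Ioo (s - r) (s + r) ∧ NormalThrough γ Q t}

/-- The orientation `ε` of the caustic is the one that its co-orientation and the orientation of
the plane determine: at each point of a fold line (that is, where `κ'(s) ≠ 0`) the two extra
normals, whose feet are close to `γ s`, appear on the left of the oriented caustic, and there are
no such normals on its right. -/
def IsCausticOrientation (γ : ℝ → ℂ) (ε : ℤˣ) : Prop :=
  ∀ s, deriv (curvature γ) s ≠ 0 →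
    ∀ᶠ r : ℝ in 𝓝[>] (0 : ℝ), ∀ᶠ δ : ℝ in 𝓝[>] (0 : ℝ),
      (normalsNear γ (center γ s + δ * (Complex.I * causticVelocity γ ε s)) s r).encard = 2 ∧
      normalsNear γ (center γ s - δ * (Complex.I * causticVelocity γ ε s)) s r = ∅

/-- The closed path `σ : [0, L] → ℂ` winds `k` times around `Q`: a continuous choice of the angle
of `σ - Q` increases by `2πk` along `[0, L]`. -/
def HasWindingNumber (σ : ℝ → ℂ) (L : ℝ) (Q : ℂ) (k : ℤ) : Prop :=
  ∃ θ : ℝ → ℝ, ContinuousOn θ (Icc 0 L) ∧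
    (∀ s ∈ Icc 0 L, σ s - Q = ‖σ s - Q‖ * Complex.exp (θ s * Complex.I)) ∧
    θ L - θ 0 = 2 * Real.pi * k

open Classical in
/-- The winding number of the closed path `σ : [0, L] → ℂ` around `Q`; see
`windingNumber_eq`. -/
def windingNumber (σ : ℝ → ℂ) (L : ℝ) (Q : ℂ) : ℤ :=
  if h : ∃ k, HasWindingNumber σ L Q k then h.choose else 0

/-- The index `i(Q)`: the winding number around `Q` of the caustic with the orientation `ε`. -/
def causticIndex (γ : ℝ → ℂ) (L : ℝ) (ε : ℤˣ) (Q : ℂ) : ℤ :=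
  windingNumber (orientedCaustic γ ε) L Q

/-- The winding number is well defined. -/
theorem HasWindingNumber.unique {σ : ℝ → ℂ} {L : ℝ} {Q : ℂ} {k l : ℤ} (hL : 0 ≤ L)
    (hQ : ∀ s ∈ Icc 0 L, σ s ≠ Q) (hk : HasWindingNumber σ L Q k)
    (hl : HasWindingNumber σ L Q l) : k = l := by
  obtain ⟨θ, hθ, hθe, hθk⟩ := hk
  obtain ⟨φ, hφ, hφe, hφl⟩ := hl
  have hpi := Real.pi_pos
  have key : ∀ s ∈ Icc 0 L, ∃ n : ℤ, (θ s - φ s) / (2 * Real.pi) = n := by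
    intro s hs
    have h0 : ((‖σ s - Q‖ : ℝ) : ℂ) ≠ 0 := by
      simpa [sub_eq_zero] using hQ s hs
    have h1 : Complex.exp (θ s * Complex.I) = Complex.exp (φ s * Complex.I) :=
      mul_left_cancel₀ h0 ((hθe s hs).symm.trans (hφe s hs))
    obtain ⟨n, hn⟩ := Complex.exp_eq_exp_iff_exists_int.1 h1
    refine ⟨n, ?_⟩
    have h2 : ((θ s : ℝ) : ℂ) = ((φ s + n * (2 * Real.pi) : ℝ) : ℂ) := by
      apply mul_right_cancel₀ Complex.I_ne_zero
      rw [hn]; push_cast; ring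
    have h3 := Complex.ofReal_injective h2
    rw [h3]; field_simp; ring
  have hc : ContinuousOn (fun s => (θ s - φ s) / (2 * Real.pi)) (Icc 0 L) :=
    (hθ.sub hφ).div_const _
  choose! n hn using key
  have hn' : ContinuousOn n (Icc 0 L) := by
    have : ContinuousOn (fun s => (n s : ℝ)) (Icc 0 L) := hc.congr fun s hs => (hn s hs).symm
    exact (Int.isClosedEmbedding_coe_real.isEmbedding.continuousOn_iff).2 this
  have heq : n L = n 0 :=
    (isPreconnected_Icc).constant hn' (right_mem_Icc.2 hL) (left_mem_Icc.2 hL)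
  have h0 := hn 0 (left_mem_Icc.2 hL)
  have h1 := hn L (right_mem_Icc.2 hL)
  rw [heq, ← h0] at h1
  field_simp at h1
  have h4 : 2 * Real.pi * (k : ℝ) = 2 * Real.pi * l := by linarith
  exact_mod_cast mul_left_cancel₀ (by positivity) h4

theorem windingNumber_eq {σ : ℝ → ℂ} {L : ℝ} {Q : ℂ} {k : ℤ} (hL : 0 ≤ L)
    (hQ : ∀ s ∈ Icc 0 L, σ s ≠ Q) (hk : HasWindingNumber σ L Q k) :
    windingNumber σ L Q = k := by
  have h : ∃ k, HasWindingNumber σ L Q k := ⟨k, hk⟩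
  rw [windingNumber, dif_pos h]
  exact HasWindingNumber.unique hL hQ h.choose_spec hk

end PlaneCaustic

end

/-! Fix `Q` off the caustic. Put `c = center γ`, `ρ = 1/κ`, let `η` be the constant sign of `κ`, and
write `T = exp(iθ)`, `Q - c = exp Λ`. Since `Q - γ = (Q - c) + ρN`, the normal at `s` contains `Q`
exactly when `Q - c` is parallel to `N`, that is, when `cos(Im Λ - θ) = 0`. At such an `s` the
velocity `c' = ρ'N` is parallel to `Q - c`, so the direction of `Q - c` is stationary while the
frame turns at rate `κ`. Hence the angle `η(Im Λ - θ)` crosses each of these levels strictly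
downwards, and its total change counts the crossings (`card_zeros_cos`), with no genericity
assumption. If `c` winds `k` times around `Q`, the total change is `2π(ηk - 1)`, because the tangent
of a convex curve turns once (`IsConvexCurve.turning_number`). So `n(Q) = 2 - 2ηk`
(`IsConvexCurve.card_normalFeet`).

Near a fold, the intersections of nearby normals with a line transverse to the caustic have a
nondegenerate extremum. This shows that `-η` is an admissible orientation
(`isCausticOrientation_neg`), and the only one if a fold exists. Then `i(Q) = -ηk`. Without folds
the caustic is a point and every index off it is zero, so the orientation is immaterial.

For the core, `n(Q) > 0` because a point of the curve nearest to `Q` is a foot. Thus `i ≥ 0`, and `n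
≥ 4` is equivalent to `i ≠ 0`. The index is constant on each domain, so the domains of the core fill
exactly the set of nonzero index. -/

namespace PlaneCaustic

/-! ### Real functions -/

/-- A function that decreases at each point where it takes the value `l` can pass this value
only once, downwards. -/
theorem lt_of_le_of_decreasing_at_level {α α' : ℝ → ℝ} {l a b : ℝ}
    (hα : ∀ s, HasDerivAt α (α' s) s) (hl : ∀ s, α s = l → α' s < 0)
    (ha : α a ≤ l) (hab : a < b) : α b < l := by
  have hle : ∀ x ∈ Icc a b, α x ≤ l :=
    image_le_of_deriv_right_lt_deriv_boundary
      (fun x _ => (hα x).continuousAt.continuousWithinAt)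
      (fun x _ => (hα x).hasDerivWithinAt) (B := fun _ => l) (B' := fun _ => 0) ha
      (fun x => hasDerivAt_const x l) (fun x _ hx => hl x hx)
  -- Equality at `b`, with negative derivative there, would put `α` above `l` just to the left of
  -- `b`.
  refine lt_of_le_of_ne (hle b (right_mem_Icc.2 hab.le)) fun hb => ?_
  have hd : deriv (fun x => l - α x) b > 0 := by
    have := ((hasDerivAt_const b l).sub (hα b)).deriv
    have h2 := hl b hb
    change deriv (fun x => l - α x) b = _ at this
    rw [this]; linarith
  have hs := eventually_nhdsWithin_sign_eq_of_deriv_pos hd (by simp [hb])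
  have hs' : ∀ᶠ x in 𝓝[<] b, SignType.sign (l - α x) = SignType.sign (x - b) :=
    hs.filter_mono nhdsWithin_le_nhds
  obtain ⟨x, hx, hxab⟩ := (hs'.and (Ioo_mem_nhdsLT hab)).exists
  have h1 : SignType.sign (x - b) = -1 := sign_eq_neg_one_iff.2 (by linarith [hxab.2])
  rw [h1, sign_eq_neg_one_iff] at hx
  linarith [hle x ⟨hxab.1.le, hxab.2.le⟩]

/-- If an angle `α` decreases at each zero of `cos α`, and by `2πk` in total on `[0, L]`, then
`cos α` has exactly `2k` zeros on `[0, L)`. -/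
theorem card_zeros_cos {α α' : ℝ → ℝ} {L : ℝ} {k : ℤ} (hL : 0 < L)
    (hα : ∀ s, HasDerivAt α (α' s) s) (hneg : ∀ s, Real.cos (α s) = 0 → α' s < 0)
    (hk : α L = α 0 - 2 * Real.pi * k) :
    {s | s ∈ Ico 0 L ∧ Real.cos (α s) = 0}.Finite ∧
      ({s | s ∈ Ico 0 L ∧ Real.cos (α s) = 0}.ncard : ℤ) = 2 * k := by
  have hpi := Real.pi_pos
  have hcosl : ∀ m : ℤ, Real.cos (Real.pi / 2 + Real.pi * m) = 0 := fun m =>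
    Real.cos_eq_zero_iff.2 ⟨m, by ring⟩
  have hcross : ∀ {m : ℤ} {a b : ℝ}, α a ≤ Real.pi / 2 + Real.pi * m → a < b →
      α b < Real.pi / 2 + Real.pi * m := fun {m a b} ha hab =>
    lt_of_le_of_decreasing_at_level hα (fun s hs => hneg s (by rw [hs]; exact hcosl m)) ha hab
  -- In this scale the zeros of `cos α` are the points where `x` is an integer, and `x` drops by
  -- `2k` in total.
  set x : ℝ → ℝ := fun s => (α s - Real.pi / 2) / Real.pi with hx
  have hxα : ∀ s, α s = Real.pi / 2 + Real.pi * x s := fun s => by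
    simp only [hx]; field_simp; ring
  have hxL : x L = x 0 - (2 * k : ℤ) := by
    simp only [hx, hk]; push_cast; field_simp; ring
  -- Needed because the cardinality of an integer interval is a truncated difference. For negative
  -- `k`, `x` would rise by at least 2 and cross the level `⌊x 0⌋ + 1` upwards.
  have hk0 : 0 ≤ k := by
    by_contra hlt
    have h1 : α 0 ≤ Real.pi / 2 + Real.pi * (⌊x 0⌋ + 1 : ℤ) := by
      rw [hxα 0]; push_cast
      have := (Int.lt_floor_add_one (x 0)).le
      gcongr
    have h2 := hcross h1 hL
    rw [hxα L, hxL] at h2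
    have h3 := Int.floor_le (x 0)
    have h4 : (k : ℝ) ≤ -1 := by
      have : k ≤ -1 := by omega
      exact_mod_cast this
    push_cast at h2
    nlinarith
  -- Each integer in `(x L, x 0]` is attained once. A zero at `0` counts and one at `L` does not,
  -- which matches the half-open interval of levels.
  have hbij : BijOn (fun s => ⌊x s⌋) {s | s ∈ Ico 0 L ∧ Real.cos (α s) = 0}
      (Ioc (⌊x 0⌋ - 2 * k) ⌊x 0⌋) := by
    have hlev : ∀ {s}, Real.cos (α s) = 0 → α s = Real.pi / 2 + Real.pi * (⌊x s⌋ : ℤ) := by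
      intro s hs
      obtain ⟨m, hm⟩ := Real.cos_eq_zero_iff.1 hs
      have : x s = m := by simp only [hx, hm]; field_simp; ring
      rw [this, Int.floor_intCast, hm]; ring
    refine ⟨?_, ?_, ?_⟩
    · rintro s ⟨⟨hs0, hsL⟩, hs⟩
      have h := hlev hs
      constructor
      · have h1 := hcross h.le hsL
        rw [hxα L, hxL] at h1
        have h2 : x 0 - (2 * k : ℤ) < ⌊x s⌋ := lt_of_mul_lt_mul_left (by linarith) hpi.le
        have h3 := Int.floor_le (x 0)
        have : ((⌊x 0⌋ - 2 * k : ℤ) : ℝ) < ⌊x s⌋ := by push_cast at h2 ⊢; linarith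
        exact_mod_cast this
      · rcases hs0.eq_or_lt with rfl | hs0
        · exact le_rfl
        · refine Int.le_floor.2 (not_lt.1 fun hlt => ?_)
          have h1 : α 0 ≤ Real.pi / 2 + Real.pi * (⌊x s⌋ : ℤ) := by
            rw [hxα 0]; gcongr
          linarith [hcross h1 hs0]
    · rintro s ⟨-, hs⟩ t ⟨-, ht⟩ hst
      have h1 := hlev hs
      have h2 := hlev ht
      dsimp only at hst
      rw [← hst] at h2
      rcases lt_trichotomy s t with h | h | h
      · linarith [hcross h1.le h]
      · exact h
      · linarith [hcross h2.le h]
    · rintro m ⟨hm1, hm2⟩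
      have h0 : Real.pi / 2 + Real.pi * m ≤ α 0 := by
        have := Int.le_floor.1 hm2
        rw [hxα 0]; gcongr
      have h1 : α L < Real.pi / 2 + Real.pi * m := by
        rw [hxα L, hxL]
        have h2 : ⌊x 0⌋ < m + 2 * k := by omega
        have h3 := Int.floor_lt.1 h2
        push_cast at h3 ⊢
        have : x 0 - 2 * k < m := by linarith
        gcongr
      have hc : ContinuousOn α (Icc 0 L) := fun s _ => (hα s).continuousAt.continuousWithinAt
      obtain ⟨s, hs, hsm⟩ := intermediate_value_Icc' hL.le hc ⟨h1.le, h0⟩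
      have hsL : s ≠ L := by rintro rfl; linarith
      refine ⟨s, ⟨⟨hs.1, lt_of_le_of_ne hs.2 hsL⟩, by rw [hsm]; exact hcosl m⟩, ?_⟩
      have : x s = m := by simp only [hx, hsm]; field_simp; ring
      simp [this]
  have hfin : {s | s ∈ Ico 0 L ∧ Real.cos (α s) = 0}.Finite :=
    hbij.finite_iff_finite.2 (finite_Ioc _ _)
  refine ⟨hfin, ?_⟩
  rw [← hbij.injOn.ncard_image, hbij.image_eq, ← Finset.coe_Ioc, ncard_coe_finset, Int.card_Ioc]
  omega

/-- The level sets of a function near a nondegenerate minimum. -/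
theorem level_sets_near_min {H : ℝ → ℝ} {s R : ℝ} (hR : 0 < R)
    (hc : ContinuousOn H (Ioo (s - R) (s + R)))
    (hs : H s = 0) (hpos : ∀ t ∈ Ioo s (s + R), 0 < deriv H t)
    (hneg : ∀ t ∈ Ioo (s - R) s, deriv H t < 0) :
    ∀ᶠ r : ℝ in 𝓝[>] (0 : ℝ), ∀ᶠ δ : ℝ in 𝓝[>] (0 : ℝ),
      {t | t ∈ Ioo (s - r) (s + r) ∧ H t = δ}.encard = 2 ∧
      {t | t ∈ Ioo (s - r) (s + r) ∧ H t = -δ} = ∅ := by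
  filter_upwards [Ioo_mem_nhdsGT hR] with r hr
  obtain ⟨hr0, hrR⟩ := hr
  have hcr : ContinuousOn H (Icc s (s + r)) :=
    hc.mono fun t ht => ⟨by linarith [ht.1], by linarith [ht.2]⟩
  have hcl : ContinuousOn H (Icc (s - r) s) :=
    hc.mono fun t ht => ⟨by linarith [ht.1], by linarith [ht.2]⟩
  have hmono : StrictMonoOn H (Icc s (s + r)) :=
    strictMonoOn_of_deriv_pos (convex_Icc _ _) hcr fun t ht => by
      rw [interior_Icc] at ht
      exact hpos t ⟨ht.1, by linarith [ht.2]⟩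
  have hanti : StrictAntiOn H (Icc (s - r) s) :=
    strictAntiOn_of_deriv_neg (convex_Icc _ _) hcl fun t ht => by
      rw [interior_Icc] at ht
      exact hneg t ⟨by linarith [ht.1], ht.2⟩
  have hsr : s ∈ Icc s (s + r) := ⟨le_rfl, by linarith⟩
  have hsl : s ∈ Icc (s - r) s := ⟨by linarith, le_rfl⟩
  have her : s + r ∈ Icc s (s + r) := ⟨by linarith, le_rfl⟩
  have hel : s - r ∈ Icc (s - r) s := ⟨le_rfl, by linarith⟩
  have hHr : 0 < H (s + r) := hs ▸ hmono hsr her (by linarith)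
  have hHl : 0 < H (s - r) := hs ▸ hanti hel hsl (by linarith)
  filter_upwards [Ioo_mem_nhdsGT (lt_min hHr hHl)] with δ hδ
  obtain ⟨hδ0, hδ1⟩ := hδ
  obtain ⟨hδr, hδl⟩ := lt_min_iff.1 hδ1
  constructor
  · obtain ⟨x, hx, hxδ⟩ := intermediate_value_Icc (by linarith) hcr ⟨by linarith, hδr.le⟩
    obtain ⟨y, hy, hyδ⟩ := intermediate_value_Icc' (by linarith) hcl ⟨by linarith, hδl.le⟩
    have hxs : x ≠ s := by rintro rfl; linarith
    have hys : y ≠ s := by rintro rfl; linarith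
    have hxr : x ≠ s + r := by rintro rfl; linarith
    have hyr : y ≠ s - r := by rintro rfl; linarith
    refine encard_eq_two.2 ⟨x, y, ?_, ?_⟩
    · rintro rfl
      exact hxs (le_antisymm hy.2 hx.1)
    · ext t
      simp only [mem_ofPred_eq, mem_insert_iff, mem_singleton_iff]
      constructor
      · rintro ⟨ht, htδ⟩
        rcases le_total s t with h | h
        · exact Or.inl (hmono.injOn ⟨h, ht.2.le⟩ hx (htδ.trans hxδ.symm))
        · exact Or.inr (hanti.injOn ⟨ht.1.le, h⟩ hy (htδ.trans hyδ.symm))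
      · rintro (rfl | rfl)
        · exact ⟨⟨by linarith [hx.1], lt_of_le_of_ne hx.2 hxr⟩, hxδ⟩
        · exact ⟨⟨lt_of_le_of_ne hy.1 hyr.symm, by linarith [hy.2]⟩, hyδ⟩
  · refine eq_empty_iff_forall_notMem.2 fun t ⟨ht, htδ⟩ => ?_
    have : 0 ≤ H t := by
      rcases le_total s t with h | h
      · exact hs ▸ hmono.monotoneOn hsr ⟨h, ht.2.le⟩ h
      · exact hs ▸ hanti.antitoneOn ⟨ht.1.le, h⟩ hsl h
    linarith

/-! ### Logarithms of curves and winding numbers -/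

/-- A curve in `ℂ \ {0}` has a differentiable logarithm. -/
theorem exists_log_of_hasDerivAt {w μ : ℝ → ℂ} (hμ : Continuous μ) (h0 : w 0 ≠ 0)
    (hw : ∀ s, HasDerivAt w (μ s * w s) s) :
    ∃ Λ : ℝ → ℂ, (∀ s, HasDerivAt Λ (μ s) s) ∧ ∀ s, Complex.exp (Λ s) = w s := by
  refine ⟨fun s => Complex.log (w 0) + ∫ x in (0 : ℝ)..s, μ x, ?_, ?_⟩
  · intro s
    exact (hμ.integral_hasStrictDerivAt 0 s).hasDerivAt.const_add _
  · intro s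
    have hI : ∀ s, HasDerivAt (fun s => ∫ x in (0 : ℝ)..s, μ x) (μ s) s := fun s =>
      (hμ.integral_hasStrictDerivAt 0 s).hasDerivAt
    -- The product is constant, so `w` is `w 0` times an exponential; its nonvanishing at other
    -- points comes for free.
    have hd : ∀ s, HasDerivAt (fun s => w s * Complex.exp (-∫ x in (0 : ℝ)..s, μ x)) 0 s := by
      intro s
      refine ((hw s).mul (hI s).neg.cexp).congr_deriv ?_
      ring
    have hc := is_const_of_deriv_eq_zero (fun s => (hd s).differentiableAt)
      (fun s => (hd s).deriv) s 0
    simp only [intervalIntegral.integral_same, neg_zero, Complex.exp_zero, mul_one] at hc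
    rw [Complex.exp_add, Complex.exp_log h0, ← hc, mul_assoc, ← Complex.exp_add]
    simp

/-- The imaginary part of a real-variable derivative. -/
theorem hasDerivAt_im {Λ : ℝ → ℂ} {μ : ℂ} {s : ℝ} (h : HasDerivAt Λ μ s) :
    HasDerivAt (fun s => (Λ s).im) μ.im s :=
  Complex.imCLM.hasFDerivAt.comp_hasDerivAt s h

/-- Reversing a closed path changes the sign of its winding number. -/
theorem HasWindingNumber.reverse {σ : ℝ → ℂ} {L : ℝ} {Q : ℂ} {k : ℤ}
    (hσ : Function.Periodic σ L) (h : HasWindingNumber σ L Q k) :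
    HasWindingNumber (fun s => σ (-s)) L Q (-k) := by
  obtain ⟨θ, hθ, he, hk⟩ := h
  have hmem : ∀ s ∈ Icc 0 L, L - s ∈ Icc 0 L := fun s hs =>
    ⟨by linarith [hs.2], by linarith [hs.1]⟩
  refine ⟨fun s => θ (L - s), hθ.comp (by fun_prop) hmem, ?_, ?_⟩
  · intro s hs
    have h1 : σ (-s) = σ (L - s) := by rw [← hσ (-s)]; congr 1; ring
    simp only [h1]
    exact he _ (hmem s hs)
  · simp only [sub_self, sub_zero]
    push_cast; linarith

/-- The winding number does not change when the point moves by less than its distance to the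
path. -/
theorem HasWindingNumber.of_norm_sub_lt {σ : ℝ → ℂ} {L : ℝ} {Q Q' : ℂ} {k : ℤ}
    (hσ : ContinuousOn σ (Icc 0 L)) (hσL : σ L = σ 0)
    (hQ : ∀ s ∈ Icc 0 L, ‖Q' - Q‖ < ‖σ s - Q‖) (h : HasWindingNumber σ L Q k) :
    HasWindingNumber σ L Q' k := by
  obtain ⟨θ, hθ, he, hk⟩ := h
  have hne : ∀ s ∈ Icc 0 L, σ s - Q ≠ 0 := fun s hs =>
    norm_pos_iff.1 ((norm_nonneg _).trans_lt (hQ s hs))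
  -- The quotient stays in the unit disc about 1, where `arg` is continuous. It has equal values at
  -- `0` and `L`, so adding its argument leaves the total turn unchanged.
  have hsl : ∀ s ∈ Icc 0 L, (σ s - Q') / (σ s - Q) ∈ Complex.slitPlane := by
    intro s hs
    have h1 : (σ s - Q') / (σ s - Q) = 1 + -((Q' - Q) / (σ s - Q)) := by
      have := hne s hs
      field_simp; ring
    rw [h1]
    refine Complex.mem_slitPlane_of_norm_lt_one ?_
    rw [norm_neg, norm_div, div_lt_one (norm_pos_iff.2 (hne s hs))]
    exact hQ s hs
  refine ⟨fun s => θ s + Complex.arg ((σ s - Q') / (σ s - Q)), ?_, ?_, ?_⟩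
  · have hc : ContinuousOn (fun s => (σ s - Q') / (σ s - Q)) (Icc 0 L) :=
      (hσ.sub continuousOn_const).div (hσ.sub continuousOn_const) hne
    exact hθ.add fun s hs =>
      ContinuousAt.comp_continuousWithinAt
        (f := fun s => (σ s - Q') / (σ s - Q)) (Complex.continuousAt_arg (hsl s hs)) (hc s hs)
  · intro s hs
    have h1 := Complex.norm_mul_exp_arg_mul_I ((σ s - Q') / (σ s - Q))
    have h2 := he s hs
    have h3 : σ s - Q' = (σ s - Q) * ((σ s - Q') / (σ s - Q)) := by
      have := hne s hs
      field_simp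
    have h4 : (‖σ s - Q'‖ : ℂ) = ‖σ s - Q‖ * ‖(σ s - Q') / (σ s - Q)‖ := by
      rw [← Complex.ofReal_mul, ← norm_mul, ← h3]
    rw [h4]
    push_cast
    rw [add_mul, Complex.exp_add]
    calc σ s - Q' = (σ s - Q) * ((σ s - Q') / (σ s - Q)) := h3
      _ = (‖σ s - Q‖ * Complex.exp (θ s * Complex.I)) * (‖(σ s - Q') / (σ s - Q)‖ *
          Complex.exp (((σ s - Q') / (σ s - Q)).arg * Complex.I)) := by rw [h1, ← h2]
      _ = _ := by ring
  · simp only [hσL]; linarith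

theorem hasWindingNumber_const (c Q : ℂ) (L : ℝ) : HasWindingNumber (fun _ => c) L Q 0 :=
  ⟨fun _ => Complex.arg (c - Q), continuousOn_const,
    fun _ _ => (Complex.norm_mul_exp_arg_mul_I _).symm, by simp⟩

/-- A logarithm of `Q - σ` computes the winding number. -/
theorem hasWindingNumber_of_exp {σ Λ : ℝ → ℂ} {L : ℝ} {Q : ℂ} {k : ℤ} (hΛ : Continuous Λ)
    (h : ∀ s, Complex.exp (Λ s) = Q - σ s) (hk : (Λ L).im - (Λ 0).im = 2 * Real.pi * k) :
    HasWindingNumber σ L Q k := by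
  -- The shift by `π` accounts for the sign between `Q - σ` and `σ - Q`.
  refine ⟨fun s => (Λ s).im + Real.pi, by fun_prop, fun s _ => ?_, by linarith⟩
  rw [← norm_neg, neg_sub, ← h s, Complex.norm_exp]
  push_cast
  rw [add_mul, Complex.exp_add, Complex.exp_pi_mul_I, ← Complex.ofReal_exp]
  rw [show σ s - Q = -(Q - σ s) by ring, ← h s]
  conv_lhs => rw [← Complex.re_add_im (Λ s), Complex.exp_add]
  push_cast
  ring

/-! ### Arclength parametrized curves -/

theorem inner_eq_re_mul_conj (a b : ℂ) : inner ℝ a b = (a * (starRingEnd ℂ) b).re := by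
  simp [Complex.inner]
  ring

variable {γ : ℝ → ℂ} {L : ℝ}

theorem IsSmoothClosedCurve.contDiff_tangent (h : IsSmoothClosedCurve γ L) :
    ContDiff ℝ ∞ (tangent γ) := h.smooth.deriv'

theorem IsSmoothClosedCurve.contDiff_normal (h : IsSmoothClosedCurve γ L) :
    ContDiff ℝ ∞ (normal γ) := contDiff_const.mul h.contDiff_tangent

theorem IsSmoothClosedCurve.contDiff_curvature (h : IsSmoothClosedCurve γ L) :
    ContDiff ℝ ∞ (curvature γ) := h.contDiff_tangent.deriv'.inner ℝ h.contDiff_normal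

theorem IsSmoothClosedCurve.hasDerivAt (h : IsSmoothClosedCurve γ L) (s : ℝ) :
    HasDerivAt γ (tangent γ s) s :=
  (h.smooth.differentiable (by simp) s).hasDerivAt

theorem IsSmoothClosedCurve.tangent_mul_conj (h : IsSmoothClosedCurve γ L) (s : ℝ) :
    tangent γ s * (starRingEnd ℂ) (tangent γ s) = 1 := by
  have := h.unit_speed s
  rw [Complex.mul_conj, Complex.normSq_eq_norm_sq, tangent, this]; simp

/-- The equation `T' = κN`. -/
theorem IsSmoothClosedCurve.hasDerivAt_tangent (h : IsSmoothClosedCurve γ L) (s : ℝ) :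
    HasDerivAt (tangent γ) (curvature γ s * Complex.I * tangent γ s) s := by
  have hd := (h.contDiff_tangent.differentiable (by simp) s).hasDerivAt
  refine hd.congr_deriv ?_
  -- Differentiating `⟨T, T⟩ = 1` shows that `T'` has no tangential component.
  have h1 : HasDerivAt (fun s => inner ℝ (tangent γ s) (tangent γ s))
      (inner ℝ (tangent γ s) (deriv (tangent γ) s) +
        inner ℝ (deriv (tangent γ) s) (tangent γ s)) s := hd.inner ℝ hd
  have hun : ∀ s, inner ℝ (tangent γ s) (tangent γ s) = 1 := fun s => by
    rw [inner_eq_re_mul_conj, h.tangent_mul_conj]; rfl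
  simp only [hun] at h1
  have h2 := h1.unique (hasDerivAt_const s (1 : ℝ))
  have h3 := hun s
  simp only [curvature, normal, Complex.inner] at h2 h3 ⊢
  set a := tangent γ s
  set b := deriv (tangent γ) s
  simp at h2 h3 ⊢
  apply Complex.ext
  · simp
    linear_combination -b.re * h3 + a.re * h2 / 2
  · simp
    linear_combination -b.im * h3 + a.im * h2 / 2

theorem IsSmoothClosedCurve.periodic_tangent (h : IsSmoothClosedCurve γ L) :
    Function.Periodic (tangent γ) L := fun s => by
  rw [tangent, tangent, ← deriv_comp_add_const]
  congr 1
  exact funext h.periodic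

theorem IsSmoothClosedCurve.periodic_curvature (h : IsSmoothClosedCurve γ L) :
    Function.Periodic (curvature γ) L := fun s => by
  have h1 : deriv (tangent γ) (s + L) = deriv (tangent γ) s := by
    rw [← deriv_comp_add_const]
    congr 1
    exact funext h.periodic_tangent
  simp only [curvature, normal, h1, h.periodic_tangent s]

theorem IsSmoothClosedCurve.periodic_center (h : IsSmoothClosedCurve γ L) :
    Function.Periodic (center γ) L := fun s => by
  simp only [center, normal, h.periodic s, h.periodic_curvature s, h.periodic_tangent s]

/-- The equation `c' = ρ'N` for the centre of curvature `c`, where `ρ = 1/κ`. -/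
theorem IsSmoothClosedCurve.hasDerivAt_center (h : IsSmoothClosedCurve γ L)
    (hκ : ∀ s, curvature γ s ≠ 0) (s : ℝ) :
    HasDerivAt (center γ)
      ((-deriv (curvature γ) s / curvature γ s ^ 2 : ℝ) * (Complex.I * tangent γ s)) s := by
  have h1 := ((h.contDiff_curvature.differentiable (by simp) s).hasDerivAt.inv (hκ s)).ofReal_comp
  have h2 := (h.hasDerivAt s).add (h1.mul ((h.hasDerivAt_tangent s).const_mul Complex.I))
  refine h2.congr_deriv ?_
  have hk : (curvature γ s : ℂ) ≠ 0 := by exact_mod_cast hκ s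
  simp only [Pi.inv_apply]
  push_cast
  field_simp
  linear_combination (tangent γ s * (curvature γ s : ℂ) ^ 2) * Complex.I_sq

theorem IsSmoothClosedCurve.continuous_center (h : IsSmoothClosedCurve γ L)
    (hκ : ∀ s, curvature γ s ≠ 0) : Continuous (center γ) :=
  continuous_iff_continuousAt.2 fun s => (h.hasDerivAt_center hκ s).continuousAt

theorem IsSmoothClosedCurve.isClosed_caustic (h : IsSmoothClosedCurve γ L)
    (hκ : ∀ s, curvature γ s ≠ 0) : IsClosed (caustic γ) := by
  rw [caustic, ← h.periodic_center.image_Icc h.pos 0]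
  exact (isCompact_Icc.image (h.continuous_center hκ)).isClosed

/-- The curvature has a constant sign. -/
theorem IsSmoothClosedCurve.exists_sign (h : IsSmoothClosedCurve γ L)
    (hκ : ∀ s, curvature γ s ≠ 0) :
    ∃ η : ℤˣ, ∀ s, 0 < ((η : ℤ) : ℝ) * curvature γ s := by
  have hc := h.contDiff_curvature.continuous
  rcases lt_or_gt_of_ne (hκ 0) with h0 | h0
  · refine ⟨-1, fun s => ?_⟩
    by_contra hs
    push_cast at hs
    obtain ⟨t, ht⟩ := mem_range_of_exists_le_of_exists_ge hc ⟨0, h0.le⟩ ⟨s, by linarith⟩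
    exact hκ t ht
  · refine ⟨1, fun s => ?_⟩
    by_contra hs
    push_cast at hs
    obtain ⟨t, ht⟩ := mem_range_of_exists_le_of_exists_ge hc ⟨s, by linarith⟩ ⟨0, h0.le⟩
    exact hκ t ht

/-- The tangent angle. -/
theorem IsSmoothClosedCurve.exists_angle (h : IsSmoothClosedCurve γ L) :
    ∃ θ : ℝ → ℝ, (∀ s, HasDerivAt θ (curvature γ s) s) ∧
      ∀ s, tangent γ s = Complex.exp (θ s * Complex.I) := by
  have hκc := h.contDiff_curvature.continuous
  have hne : tangent γ 0 ≠ 0 := fun h0 => by simpa [h0] using h.tangent_mul_conj 0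
  obtain ⟨Λ, hΛ, he⟩ := exists_log_of_hasDerivAt (μ := fun s => curvature γ s * Complex.I)
    (by fun_prop) hne h.hasDerivAt_tangent
  refine ⟨fun s => (Λ s).im, fun s => ?_, fun s => ?_⟩
  · simpa using hasDerivAt_im (hΛ s)
  · have h1 : Real.exp (Λ s).re = 1 := by
      rw [← Complex.norm_exp, he s]; exact h.unit_speed s
    have h2 : (Λ s).re = 0 := by simpa using h1
    rw [← he s]
    conv_lhs => rw [← Complex.re_add_im (Λ s), h2]
    simp

/-! ### The turning number of a convex curve -/

/-- The tangent lines of a convex curve are supporting lines. -/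
theorem IsConvexCurve.exists_support (h : IsConvexCurve γ L) {η : ℤˣ}
    (hη : ∀ s, 0 < ((η : ℤ) : ℝ) * curvature γ s) :
    ∃ K : Set ℂ, Convex ℝ K ∧ IsClosed K ∧ range γ = frontier K ∧
      (∀ s, ∀ x ∈ K, 0 ≤ ((η : ℤ) : ℝ) * inner ℝ (x - γ s) (normal γ s)) ∧
      (∀ s, ∀ x ∈ interior K, 0 < ((η : ℤ) : ℝ) * inner ℝ (x - γ s) (normal γ s)) := by
  obtain ⟨K, hK, hcpt, hint, hfr⟩ := h.convex
  have hsupp : ∀ s, ∃ d : ℝ, 0 < d ∧ ∃ f : ℂ →L[ℝ] ℝ,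
      (∀ x ∈ interior K, f x < f (γ s)) ∧ ∀ x, f (x - γ s) =
        -d * (((η : ℤ) : ℝ) * inner ℝ (x - γ s) (normal γ s)) := by
    intro s
    have hs : γ s ∈ frontier K := hfr ▸ mem_range_self s
    obtain ⟨f, hf⟩ := geometric_hahn_banach_open_point hK.interior isOpen_interior hs.2
    have hle : ∀ x ∈ K, f x ≤ f (γ s) := by
      intro x hx
      have hx' : x ∈ closure (interior K) := by
        rw [hK.closure_interior_eq_closure_of_nonempty_interior hint]
        exact subset_closure hx
      exact closure_minimal (fun y hy => (hf y hy).le)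
        (isClosed_le f.continuous continuous_const) hx'
    have hmem : ∀ t, γ t ∈ K := fun t =>
      hcpt.isClosed.frontier_subset (hfr ▸ mem_range_self t)
    have hd1 : ∀ t, HasDerivAt (fun t => f (γ t)) (f (tangent γ t)) t := fun t =>
      f.hasFDerivAt.comp_hasDerivAt t (h.hasDerivAt t)
    have hd2 : ∀ t, HasDerivAt (fun t => f (tangent γ t))
        (f (curvature γ t * Complex.I * tangent γ t)) t := fun t =>
      f.hasFDerivAt.comp_hasDerivAt t (h.hasDerivAt_tangent t)
    -- The maximum kills the tangential component of `f`, so `f` is a multiple of the inner product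
    -- with `N(s)`.
    have hmax : IsLocalMax (fun t => f (γ t)) s := Eventually.of_forall fun t => hle _ (hmem t)
    have hT : f (tangent γ s) = 0 := hmax.hasDerivAt_eq_zero (hd1 s)
    have hdec : ∀ x, f (x - γ s) = inner ℝ (x - γ s) (normal γ s) * f (normal γ s) := by
      intro x
      have h1 : x - γ s = (inner ℝ (x - γ s) (tangent γ s) : ℝ) • tangent γ s +
          (inner ℝ (x - γ s) (normal γ s) : ℝ) • normal γ s := by
        have h3 := congrArg Complex.re (h.tangent_mul_conj s)
        generalize x - γ s = v
        simp [normal, Complex.inner] at h3 ⊢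
        apply Complex.ext
        · simp
          linear_combination (-v.re) * h3
        · simp
          linear_combination (-v.im) * h3
      conv_lhs => rw [h1]
      rw [map_add, map_smul, map_smul, hT, smul_zero, zero_add, smul_eq_mul]
    have hN : f (curvature γ s * Complex.I * tangent γ s) = curvature γ s * f (normal γ s) := by
      rw [← smul_eq_mul (curvature γ s) (f _), ← map_smul, Complex.real_smul, normal, mul_assoc]
    have hN0 : f (normal γ s) ≠ 0 := by
      intro h0
      obtain ⟨x, hx⟩ := hint
      have h1 := hf x hx
      have h2 := hdec x
      rw [h0, mul_zero, map_sub] at h2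
      linarith
    -- This is the second derivative of `f ∘ γ` at its maximum. If it were positive, `s` would also
    -- be a local minimum, `f ∘ γ` would be locally constant, and the second derivative would
    -- vanish.
    have hsign : curvature γ s * f (normal γ s) ≤ 0 := by
      by_contra hpos
      have hdd : deriv (fun t => f (γ t)) = fun t => f (tangent γ t) :=
        funext fun t => (hd1 t).deriv
      have hmin : IsLocalMin (fun t => f (γ t)) s := by
        refine isLocalMin_of_deriv_deriv_pos ?_ ?_ (hd1 s).continuousAt
        · rw [hdd, (hd2 s).deriv, hN]; exact not_le.1 hpos
        · rw [hdd]; exact hT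
      have heq : (fun t => f (γ t)) =ᶠ[𝓝 s] fun _ => f (γ s) := by
        filter_upwards [hmax, hmin] with t h1 h2 using le_antisymm h1 h2
      have h1 := heq.deriv.deriv_eq
      rw [hdd, (hd2 s).deriv, hN] at h1
      simp at h1
      exact hpos (le_of_eq (mul_eq_zero.2 h1))
    have hη2 : ((η : ℤ) : ℝ) * ((η : ℤ) : ℝ) = 1 := by
      exact_mod_cast Int.units_coe_mul_self η
    refine ⟨-(((η : ℤ) : ℝ) * f (normal γ s)), ?_, f, hf, fun x => ?_⟩
    · have h1 := hη s
      have h2 : 0 ≤ -(((η : ℤ) : ℝ) * f (normal γ s)) := by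
        have h3 : (((η : ℤ) : ℝ) * curvature γ s) * (((η : ℤ) : ℝ) * f (normal γ s)) ≤ 0 := by
          linear_combination hsign + curvature γ s * f (normal γ s) * hη2
        nlinarith
      refine lt_of_le_of_ne h2 (Ne.symm (neg_ne_zero.2 (mul_ne_zero ?_ hN0)))
      rintro h0
      rw [h0] at hη2
      norm_num at hη2
    · rw [hdec x]
      linear_combination (-inner ℝ (x - γ s) (normal γ s) * f (normal γ s)) * hη2
  have hpos : ∀ s, ∀ x ∈ interior K, 0 < ((η : ℤ) : ℝ) * inner ℝ (x - γ s) (normal γ s) := by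
    intro s x hx
    obtain ⟨d, hd, f, hf, hfd⟩ := hsupp s
    have h1 := hf x hx
    have h2 := hfd x
    rw [map_sub] at h2
    by_contra hle
    nlinarith
  refine ⟨K, hK, hcpt.isClosed, hfr, fun s x hx => ?_, hpos⟩
  have hx' : x ∈ closure (interior K) := by
    rw [hK.closure_interior_eq_closure_of_nonempty_interior hint]
    exact subset_closure hx
  have hc : Continuous fun x => ((η : ℤ) : ℝ) * inner ℝ (x - γ s) (normal γ s) :=
    continuous_const.mul ((continuous_id.sub continuous_const).inner continuous_const)
  exact closure_minimal (fun y hy => (hpos s y hy).le) (isClosed_le continuous_const hc) hx'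

/-- The tangent of a convex curve without flat points makes exactly one turn. -/
theorem IsConvexCurve.turning_number (h : IsConvexCurve γ L) {η : ℤˣ}
    (hη : ∀ s, 0 < ((η : ℤ) : ℝ) * curvature γ s) {θ : ℝ → ℝ}
    (hθ : ∀ s, HasDerivAt θ (curvature γ s) s)
    (hT : ∀ s, tangent γ s = Complex.exp (θ s * Complex.I)) :
    θ L = θ 0 + 2 * Real.pi * (η : ℤ) := by
  have hpi := Real.pi_pos
  have hη2 : ((η : ℤ) : ℝ) * ((η : ℤ) : ℝ) = 1 := by
    exact_mod_cast Int.units_coe_mul_self η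
  set φ : ℝ → ℝ := fun s => ((η : ℤ) : ℝ) * (θ s - θ 0) with hφdef
  have hφ : ∀ s, HasDerivAt φ (((η : ℤ) : ℝ) * curvature γ s) s := fun s =>
    ((hθ s).sub_const (θ 0)).const_mul _
  have hφm : StrictMono φ := strictMono_of_deriv_pos fun s => by rw [(hφ s).deriv]; exact hη s
  have hφ0 : φ 0 = 0 := by simp [hφdef]
  have hθφ : ∀ s, θ s = θ 0 + ((η : ℤ) : ℝ) * φ s := fun s => by
    simp only [hφdef]; linear_combination (-(θ s - θ 0)) * hη2
  obtain ⟨m, hm⟩ : ∃ m : ℤ, φ L = 2 * Real.pi * m := by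
    have h1 : Complex.exp (θ L * Complex.I) = Complex.exp (θ 0 * Complex.I) := by
      rw [← hT, ← hT, ← h.periodic_tangent 0, zero_add]
    obtain ⟨n, hn⟩ := Complex.exp_eq_exp_iff_exists_int.1 h1
    have h2 : ((θ L : ℝ) : ℂ) = ((θ 0 + n * (2 * Real.pi) : ℝ) : ℂ) := by
      apply mul_right_cancel₀ Complex.I_ne_zero
      rw [hn]; push_cast; ring
    have h3 := Complex.ofReal_injective h2
    refine ⟨η * n, ?_⟩
    simp only [hφdef, h3]; push_cast; ring
  have hm1 : 1 ≤ m := by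
    have h1 := hφm h.pos
    rw [hφ0, hm] at h1
    have h2 : (0 : ℝ) < m := pos_of_mul_pos_right h1 (by positivity)
    exact_mod_cast h2
  suffices hm2 : m ≤ 1 by
    have : m = 1 := le_antisymm hm2 hm1
    rw [hθφ L, hm, this]; push_cast; ring
  -- A second turn yields another point `γ u` with the tangent of `γ 0`. Both then lie on one
  -- supporting line, so the segment between them lies on the curve. Its infinitely many points have
  -- tangents parallel to `T(0)`, but only finitely many parameters in a period allow this.
  by_contra hm2
  have hm2' : (2 : ℝ) ≤ m := by exact_mod_cast not_le.1 hm2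
  obtain ⟨u, hu, huφ⟩ := intermediate_value_Icc h.pos.le
    (fun s _ => (hφ s).continuousAt.continuousWithinAt)
    (show 2 * Real.pi ∈ Icc (φ 0) (φ L) from ⟨by rw [hφ0]; positivity, by rw [hm]; nlinarith⟩)
  have hu0 : u ≠ 0 := by rintro rfl; rw [hφ0] at huφ; linarith
  have huL : u ≠ L := by rintro rfl; rw [hm] at huφ; nlinarith
  have hγu : γ 0 ≠ γ u := fun he =>
    hu0 (h.simple ⟨le_rfl, h.pos⟩ ⟨hu.1, lt_of_le_of_ne hu.2 huL⟩ he).symm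
  have hTu : tangent γ u = tangent γ 0 := by
    rw [hT u, hT 0, Complex.exp_eq_exp_iff_exists_int]
    refine ⟨η, ?_⟩
    rw [hθφ u, huφ]; push_cast; ring
  obtain ⟨K, hK, hcl, hfr, hnn, hpos⟩ := h.exists_support hη
  have hmem : ∀ t, γ t ∈ K := fun t => hcl.frontier_subset (hfr ▸ mem_range_self t)
  set g : ℂ → ℝ := fun x => ((η : ℤ) : ℝ) * inner ℝ (x - γ 0) (normal γ 0) with hg
  -- Two supporting half-planes with the same inner normal, each containing the other's boundary
  -- point, have the same boundary line.
  have hgu : g (γ u) = 0 := by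
    refine le_antisymm ?_ (hnn 0 _ (hmem u))
    have h1 := hnn u _ (hmem 0)
    simp only [normal, hTu] at h1
    simp only [hg, normal]
    rw [← neg_sub, inner_neg_left] at h1
    linarith
  have hg0 : g (γ 0) = 0 := by simp [hg]
  have hgline : ∀ l : ℝ, g (AffineMap.lineMap (γ 0) (γ u) l) = 0 := by
    intro l
    have : (AffineMap.lineMap (γ 0) (γ u) l : ℂ) - γ 0 = l • (γ u - γ 0) := by
      simp [AffineMap.lineMap_apply]
    simp only [hg] at hgu ⊢
    rw [this, real_inner_smul_left]
    linear_combination l * hgu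
  -- With this angle the cosine is `sin φ`, whose zeros are the parameters with tangent parallel to
  -- `T(0)`; only finiteness is used.
  have hzeros := (card_zeros_cos (α := fun s => Real.pi / 2 - φ s)
    (α' := fun s => -(((η : ℤ) : ℝ) * curvature γ s)) (k := m) h.pos
    (fun s => (hφ s).const_sub _) (fun s _ => neg_neg_of_pos (hη s))
    (by simp only [hφ0, hm]; ring)).1
  refine (Infinite.image (f := fun l : ℝ => (AffineMap.lineMap (γ 0) (γ u) l : ℂ))
    (AffineMap.lineMap_injective ℝ hγu).injOn (Icc_infinite (zero_lt_one (α := ℝ))))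
    ((hzeros.image γ).subset ?_)
  rintro _ ⟨l, hl, rfl⟩
  have hlK : (AffineMap.lineMap (γ 0) (γ u) l : ℂ) ∈ K :=
    hK.lineMap_mem (hmem 0) (hmem u) hl
  have hlfr : (AffineMap.lineMap (γ 0) (γ u) l : ℂ) ∈ frontier K :=
    ⟨subset_closure hlK, fun hi => (hpos 0 _ hi).ne' (hgline l)⟩
  rw [← hfr] at hlfr
  obtain ⟨t', ht'⟩ := hlfr
  obtain ⟨t, ht, htt'⟩ := h.periodic.exists_mem_Ico₀ h.pos t'
  refine ⟨t, ⟨ht, ?_⟩, by dsimp only; rw [← ht', htt']⟩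
  have hmin : IsLocalMin (fun s => g (γ s)) t := Eventually.of_forall fun s => by
    dsimp only
    rw [← htt', ht', hgline l]
    exact hnn 0 _ (hmem s)
  have hd : HasDerivAt (fun s => g (γ s)) (((η : ℤ) : ℝ) * inner ℝ (tangent γ t) (normal γ 0)) t := by
    have := (((h.hasDerivAt t).sub_const (γ 0)).inner ℝ
      (hasDerivAt_const t (normal γ 0))).const_mul ((η : ℤ) : ℝ)
    rwa [inner_zero_right, zero_add] at this
  have h0 := hmin.hasDerivAt_eq_zero hd
  have h1 : inner ℝ (tangent γ t) (normal γ 0) = Real.sin (θ t - θ 0) := by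
    rw [normal, hT, hT, Real.sin_sub]
    simp [Complex.inner, Complex.exp_ofReal_mul_I_re, Complex.exp_ofReal_mul_I_im]
    ring
  have h2 : Real.sin (θ t - θ 0) = 0 := by
    rw [h1] at h0
    linear_combination ((η : ℤ) : ℝ) * h0 - Real.sin (θ t - θ 0) * hη2
  rw [Real.cos_pi_div_two_sub]
  rcases Int.units_eq_one_or η with rfl | rfl
  · simpa [hφdef] using h2
  · have : φ t = -(θ t - θ 0) := by simp [hφdef]
    rw [this, Real.sin_neg, h2, neg_zero]

/-! ### The number of normals and the winding number -/

/-- The squared distance from `Q` attains its minimum over a period, and its critical points are the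
feet of normals. Later this excludes negative indices. -/
theorem IsSmoothClosedCurve.exists_normalThrough (h : IsSmoothClosedCurve γ L) (Q : ℂ) :
    ∃ s, NormalThrough γ Q s := by
  have hd : ∀ s, HasDerivAt (fun s => ‖Q - γ s‖ ^ 2) (2 * inner ℝ (Q - γ s) (-tangent γ s)) s :=
    fun s => ((h.hasDerivAt s).const_sub Q).norm_sq
  obtain ⟨s, -, hs⟩ := isCompact_Icc.exists_isMinOn (nonempty_Icc.2 h.pos.le)
    (fun s _ => (hd s).continuousAt.continuousWithinAt)
  refine ⟨s, ?_⟩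
  have hmin : IsLocalMin (fun s => ‖Q - γ s‖ ^ 2) s := Eventually.of_forall fun t => by
    obtain ⟨u, hu, htu⟩ := h.periodic.exists_mem_Ico₀ h.pos t
    dsimp only
    rw [htu]
    exact hs (Ico_subset_Icc_self hu)
  have h0 := hmin.hasDerivAt_eq_zero (hd s)
  rw [inner_neg_right] at h0
  rw [NormalThrough]
  linarith

theorem IsSmoothClosedCurve.normalFeet_eq_image (h : IsSmoothClosedCurve γ L) (Q : ℂ) :
    normalFeet γ Q = γ '' {s | s ∈ Ico 0 L ∧ NormalThrough γ Q s} := by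
  have hper : Function.Periodic (NormalThrough γ Q) L := fun s => by
    simp only [NormalThrough, h.periodic s, h.periodic_tangent s]
  have hpair : Function.Periodic (fun s => (γ s, NormalThrough γ Q s)) L := fun s => by
    simp only [h.periodic s, hper s]
  ext P
  constructor
  · rintro ⟨s, rfl, hs⟩
    obtain ⟨t, ht, hst⟩ := hpair.exists_mem_Ico₀ h.pos s
    obtain ⟨h1, h2⟩ := Prod.mk.inj hst
    exact ⟨t, ⟨ht, h2 ▸ hs⟩, h1.symm⟩
  · rintro ⟨s, ⟨-, hs⟩, rfl⟩
    exact ⟨s, rfl, hs⟩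

/-- The number of normals in terms of the winding number of the curve of curvature centres. -/
theorem IsConvexCurve.card_normalFeet (h : IsConvexCurve γ L) (hκ : ∀ s, curvature γ s ≠ 0)
    {η : ℤˣ} (hη : ∀ s, 0 < ((η : ℤ) : ℝ) * curvature γ s) {Q : ℂ} (hQ : Q ∉ caustic γ) :
    ∃ k : ℤ, HasWindingNumber (center γ) L Q k ∧ (normalFeet γ Q).Finite ∧
      ((normalFeet γ Q).ncard : ℤ) = 2 - 2 * (η * k) := by
  have hη2 : (η : ℤ) * η = 1 := Int.units_coe_mul_self η
  have hne : ∀ s, Q - center γ s ≠ 0 := fun s hs => hQ ⟨s, (sub_eq_zero.1 hs).symm⟩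
  obtain ⟨θ, hθ, hT⟩ := h.exists_angle
  set r : ℝ → ℝ := fun s => -deriv (curvature γ) s / curvature γ s ^ 2 with hr
  have hrc : Continuous r :=
    (h.contDiff_curvature.continuous_deriv (by simp)).neg.div₀
      (h.contDiff_curvature.continuous.pow 2) fun s => pow_ne_zero 2 (hκ s)
  have hTc := h.contDiff_tangent.continuous
  have hcc := h.continuous_center hκ
  obtain ⟨Λ, hΛ, he⟩ := exists_log_of_hasDerivAt
    (w := fun s => Q - center γ s)
    (μ := fun s => -(r s * (Complex.I * tangent γ s)) / (Q - center γ s))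
    (Continuous.div₀ (by fun_prop) (by fun_prop) hne) (hne 0) (fun s => by
      rw [div_mul_cancel₀ _ (hne s)]
      exact (h.hasDerivAt_center hκ s).const_sub Q)
  obtain ⟨k, hk⟩ : ∃ k : ℤ, (Λ L).im - (Λ 0).im = 2 * Real.pi * k := by
    have h1 : Complex.exp (Λ L) = Complex.exp (Λ 0) := by
      rw [he, he, ← h.periodic_center 0, zero_add]
    obtain ⟨n, hn⟩ := Complex.exp_eq_exp_iff_exists_int.1 h1
    refine ⟨n, ?_⟩
    rw [hn]
    simp
    ring
  have hΛc : Continuous Λ := continuous_iff_continuousAt.2 fun s => (hΛ s).continuousAt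
  refine ⟨k, hasWindingNumber_of_exp hΛc he hk, ?_⟩
  have hcosη : ∀ x : ℝ, Real.cos (((η : ℤ) : ℝ) * x) = Real.cos x := by
    intro x
    rcases Int.units_eq_one_or η with rfl | rfl <;> simp
  have hnormal : ∀ s, NormalThrough γ Q s ↔
      Real.cos (((η : ℤ) : ℝ) * ((Λ s).im - θ s)) = 0 := by
    intro s
    have h1 : (Q - γ s) * (starRingEnd ℂ) (tangent γ s) =
        Complex.exp (Λ s - θ s * Complex.I) + ((curvature γ s)⁻¹ : ℝ) * Complex.I := by
      have h2 : (starRingEnd ℂ) (tangent γ s) = Complex.exp (-(θ s * Complex.I)) := by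
        rw [hT, ← Complex.exp_conj]; simp
      rw [sub_eq_add_neg (Λ s), Complex.exp_add, he, ← h2]
      simp only [center, normal]
      linear_combination (((curvature γ s)⁻¹ : ℝ) * Complex.I) * h.tangent_mul_conj s
    rw [hcosη, NormalThrough, inner_eq_re_mul_conj, h1, Complex.add_re, Complex.exp_re]
    simp
  have hcount := card_zeros_cos (α := fun s => ((η : ℤ) : ℝ) * ((Λ s).im - θ s))
    (k := 1 - η * k) h.pos (fun s => ((hasDerivAt_im (hΛ s)).sub (hθ s)).const_mul _)
    -- At a zero, `(Q - c)'` is a real multiple of `Q - c`, so `Im Λ` is stationary and the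
    -- derivative reduces to `-ηκ`.
    (fun s hs => by
      have h1 : (-(r s * (Complex.I * tangent γ s)) / (Q - center γ s)).im = 0 := by
        have h2 : -(r s * (Complex.I * tangent γ s)) / (Q - center γ s) =
            (-r s : ℝ) * (Complex.I * Complex.exp (θ s * Complex.I - Λ s)) := by
          rw [← he, hT, Complex.exp_sub]; push_cast; ring
        rw [hcosη, ← Real.cos_neg, neg_sub] at hs
        rw [h2, Complex.im_ofReal_mul, Complex.I_mul_im, Complex.exp_re]
        simp [hs]
      rw [h1]
      linarith [hη s])
    (by
      have h1 := h.turning_number hη hθ hT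
      have h2 : ((η : ℤ) : ℝ) * ((η : ℤ) : ℝ) = 1 := by exact_mod_cast hη2
      push_cast
      linear_combination ((η : ℤ) : ℝ) * hk - ((η : ℤ) : ℝ) * h1 - 2 * Real.pi * h2)
  have hset : {s | s ∈ Ico 0 L ∧ NormalThrough γ Q s} =
      {s | s ∈ Ico 0 L ∧ Real.cos (((η : ℤ) : ℝ) * ((Λ s).im - θ s)) = 0} := by
    ext s
    exact and_congr_right fun _ => hnormal s
  rw [h.normalFeet_eq_image, hset]
  refine ⟨hcount.1.image γ, ?_⟩
  rw [InjOn.ncard_image (h.simple.mono fun s hs => hs.1), hcount.2]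
  ring

/-! ### The orientation of the caustic -/

/-- The orientation of the caustic is opposite to the sign of the curvature. -/
theorem IsSmoothClosedCurve.isCausticOrientation_neg (h : IsSmoothClosedCurve γ L)
    (hκ : ∀ s, curvature γ s ≠ 0) {η : ℤˣ} (hη : ∀ s, 0 < ((η : ℤ) : ℝ) * curvature γ s) :
    IsCausticOrientation γ (-η) := by
  intro s hs
  have hη2 : ((η : ℤ) : ℝ) * ((η : ℤ) : ℝ) = 1 := by
    exact_mod_cast Int.units_coe_mul_self η
  have hρ : HasDerivAt (fun t => (curvature γ t)⁻¹)
      (-deriv (curvature γ) s / curvature γ s ^ 2) s :=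
    (h.contDiff_curvature.differentiable (by simp) s).hasDerivAt.inv (hκ s)
  have hcd := (h.hasDerivAt_center hκ s).deriv
  have hr : -deriv (curvature γ) s / curvature γ s ^ 2 ≠ 0 :=
    div_ne_zero (neg_ne_zero.2 hs) (pow_ne_zero 2 (hκ s))
  set r := -deriv (curvature γ) s / curvature γ s ^ 2
  have hvel : Complex.I * causticVelocity γ (-η) s =
      ((((η : ℤ) : ℝ) * r : ℝ) : ℂ) * tangent γ s := by
    rw [causticVelocity, hcd]
    push_cast
    linear_combination (-((η : ℤ) : ℂ) * r * tangent γ s) * Complex.I_sq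
  set F : ℝ → ℝ := fun t => inner ℝ (center γ s - γ t) (tangent γ t) with hF
  set p : ℝ → ℝ := fun t => inner ℝ (tangent γ s) (tangent γ t) with hp
  -- Since `⟨N(t), N(s)⟩ = p t`, this is `⟨c(s) - c(t), N(s)⟩`. It vanishes at `s` with derivative
  -- `-ρ'(s) = -r`.
  set b : ℝ → ℝ := fun t =>
    inner ℝ (center γ s - γ t) (normal γ s) - (curvature γ t)⁻¹ * p t with hb
  have hun : ∀ t, (tangent γ t).re * (tangent γ t).re + (tangent γ t).im * (tangent γ t).im = 1 :=
    fun t => by simpa using congrArg Complex.re (h.tangent_mul_conj t)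
  have hFd : ∀ t, HasDerivAt F (inner ℝ (center γ s - γ t)
      (curvature γ t * Complex.I * tangent γ t) + inner ℝ (-tangent γ t) (tangent γ t)) t :=
    fun t => ((h.hasDerivAt t).const_sub _).inner ℝ (h.hasDerivAt_tangent t)
  have hpd : ∀ t, HasDerivAt p
      (inner ℝ (tangent γ s) (curvature γ t * Complex.I * tangent γ t)) t := fun t => by
    have := (hasDerivAt_const t (tangent γ s)).inner ℝ (h.hasDerivAt_tangent t)
    rwa [inner_zero_left, add_zero] at this
  have hps : p s = 1 := by
    simp only [hp, inner_eq_re_mul_conj, h.tangent_mul_conj, Complex.one_re]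
  -- The normal at `t` meets the line through `c(s)` in the direction `T(s)` at `c(s) + H(t) η r
  -- T(s)`. As `H'` has the sign of `-b/r`, which increases through 0 at `s`, `H` has a strict
  -- minimum there.
  set H : ℝ → ℝ := fun t => -(((η : ℤ) : ℝ) / r) * (F t / p t) with hH
  have hHd : ∀ t, p t ≠ 0 →
      HasDerivAt H (((η : ℤ) : ℝ) * curvature γ t / p t ^ 2 * (-(1 / r) * b t)) t := by
    intro t ht
    refine (((hFd t).div (hpd t) ht).const_mul (-(((η : ℤ) : ℝ) / r))).congr_deriv ?_
    have h1 : (inner ℝ (center γ s - γ t) (curvature γ t * Complex.I * tangent γ t) +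
        inner ℝ (-tangent γ t) (tangent γ t)) * p t -
        F t * inner ℝ (tangent γ s) (curvature γ t * Complex.I * tangent γ t) =
        curvature γ t * b t := by
      have hkk : curvature γ t * (curvature γ t)⁻¹ = 1 := mul_inv_cancel₀ (hκ t)
      have h2 := hun t
      rw [inner_neg_left, inner_eq_re_mul_conj (tangent γ t), h.tangent_mul_conj, Complex.one_re]
      simp only [hb, hF, hp, normal]
      generalize center γ s - γ t = v
      generalize (curvature γ t)⁻¹ = ρ at hkk ⊢
      simp [Complex.inner]
      linear_combination (curvature γ t * (v.im * (tangent γ s).re - v.re * (tangent γ s).im)) * h2 +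
        ((tangent γ t).re * (tangent γ s).re + (tangent γ t).im * (tangent γ s).im) * hkk
    rw [h1]
    ring
  have hFs : F s = 0 := by
    simp [hF, center, normal, Complex.inner]
    ring
  have hbs : -(1 / r) * b s = 0 := by
    have h2 := hun s
    have : b s = 0 := by
      simp only [hb, hps]
      simp [center, normal, Complex.inner]
      linear_combination (curvature γ s)⁻¹ * h2
    rw [this, mul_zero]
  have hbd : deriv (fun t => -(1 / r) * b t) s > 0 := by
    have h1 : HasDerivAt (fun t => -(1 / r) * b t) _ s :=
      ((((h.hasDerivAt s).const_sub (center γ s)).inner ℝ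
        (hasDerivAt_const s (normal γ s))).sub (hρ.mul (hpd s))).const_mul (-(1 / r))
    rw [h1.deriv, hps]
    have h3 : inner ℝ (-tangent γ s) (normal γ s) = (0 : ℝ) := by
      simp [normal, Complex.inner]; ring
    have h4 : inner ℝ (tangent γ s) (curvature γ s * Complex.I * tangent γ s) = (0 : ℝ) := by
      simp [Complex.inner]; ring
    rw [h3, h4, inner_zero_right]
    have : -(1 / r) * (0 + 0 - (r * 1 + (curvature γ s)⁻¹ * 0)) = 1 := by field_simp; ring
    rw [this]; exact one_pos
  have hsign := eventually_nhdsWithin_sign_eq_of_deriv_pos hbd hbs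
  have hpc : ∀ᶠ t in 𝓝 s, 0 < p t :=
    (hpd s).continuousAt.eventually (lt_mem_nhds (by rw [hps]; exact one_pos))
  obtain ⟨R, hR, hball⟩ := Metric.eventually_nhds_iff_ball.1 (hsign.and hpc)
  rw [Real.ball_eq_Ioo] at hball
  have hfac : ∀ t ∈ Ioo (s - R) (s + R), 0 < ((η : ℤ) : ℝ) * curvature γ t / p t ^ 2 :=
    fun t ht => div_pos (hη t) (pow_pos (hball t ht).2 2)
  have hlev := level_sets_near_min (H := H) hR
    (fun t ht => (hHd t (hball t ht).2.ne').continuousAt.continuousWithinAt)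
    (by simp [hH, hFs])
    (fun t ht => by
      have htR : t ∈ Ioo (s - R) (s + R) := ⟨by linarith [ht.1], ht.2⟩
      rw [(hHd t (hball t htR).2.ne').deriv]
      have h1 := (hball t htR).1
      rw [sign_pos (sub_pos.2 ht.1), sign_eq_one_iff] at h1
      exact mul_pos (hfac t htR) h1)
    (fun t ht => by
      have htR : t ∈ Ioo (s - R) (s + R) := ⟨ht.1, by linarith [ht.2]⟩
      rw [(hHd t (hball t htR).2.ne').deriv]
      have h1 := (hball t htR).1
      rw [sign_neg (sub_neg.2 ht.2), sign_eq_neg_one_iff] at h1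
      exact mul_neg_of_pos_of_neg (hfac t htR) h1)
  have hiff : ∀ t ∈ Ioo (s - R) (s + R), ∀ δ : ℝ,
      NormalThrough γ (center γ s + δ * (Complex.I * causticVelocity γ (-η) s)) t ↔ H t = δ := by
    intro t ht δ
    have hpt := (hball t ht).2.ne'
    have h1 : inner ℝ (center γ s + δ * (Complex.I * causticVelocity γ (-η) s) - γ t)
        (tangent γ t) = F t + δ * (((η : ℤ) : ℝ) * r) * p t := by
      rw [hvel, ← mul_assoc, ← Complex.ofReal_mul, ← Complex.real_smul, add_sub_right_comm,
        inner_add_left, real_inner_smul_left]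
    rw [NormalThrough, h1]
    have hη0 : ((η : ℤ) : ℝ) ≠ 0 := left_ne_zero_of_mul_eq_one hη2
    have h2 : F t + δ * (((η : ℤ) : ℝ) * r) * p t = (((η : ℤ) : ℝ) * r * p t) * (δ - H t) := by
      simp only [hH]
      field_simp
      linear_combination (-F t) * hη2
    rw [h2, mul_eq_zero, or_iff_right (mul_ne_zero (mul_ne_zero hη0 hr) hpt), sub_eq_zero, eq_comm]
  filter_upwards [hlev, Ioo_mem_nhdsGT hR] with r' hr' hr'R
  filter_upwards [hr'] with δ hδ
  have hset : ∀ δ : ℝ, normalsNear γ (center γ s + δ * (Complex.I * causticVelocity γ (-η) s)) s r'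
      = {t | t ∈ Ioo (s - r') (s + r') ∧ H t = δ} := fun δ => by
    ext t
    exact and_congr_right fun ht =>
      hiff t ⟨by linarith [ht.1, hr'R.2], by linarith [ht.2, hr'R.2]⟩ δ
  refine ⟨by rw [hset]; exact hδ.1, ?_⟩
  rw [← hδ.2, ← hset, Complex.ofReal_neg, neg_mul, ← sub_eq_add_neg]

/-- If the caustic has a fold point, then its co-orientation determines its orientation. -/
theorem IsCausticOrientation.unique {ε ε' : ℤˣ} (hε : IsCausticOrientation γ ε)
    (hε' : IsCausticOrientation γ ε') {s : ℝ} (hs : deriv (curvature γ) s ≠ 0) : ε = ε' := by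
  by_contra hne
  obtain rfl := Int.units_ne_iff_eq_neg.1 hne
  obtain ⟨r, h1, h2⟩ := ((hε s hs).and (hε' s hs)).exists
  obtain ⟨δ, h3, h4⟩ := (h1.and h2).exists
  have hvel : causticVelocity γ (-ε') s = -causticVelocity γ ε' s := by
    simp [causticVelocity]
  rw [hvel, mul_neg, mul_neg, sub_neg_eq_add] at h3
  have h5 := h4.1
  rw [h3.2] at h5
  simp at h5

/-! ### The index of the oriented caustic and the core -/

theorem HasWindingNumber.orientedCaustic {Q : ℂ} {k : ℤ} (hper : Function.Periodic (center γ) L)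
    (h : HasWindingNumber (center γ) L Q k) (ε : ℤˣ) :
    HasWindingNumber (orientedCaustic γ ε) L Q (ε * k) := by
  rcases Int.units_eq_one_or ε with rfl | rfl
  · have : PlaneCaustic.orientedCaustic γ 1 = center γ := by
      funext s; simp [PlaneCaustic.orientedCaustic]
    rw [this]; simpa using h
  · have : PlaneCaustic.orientedCaustic γ (-1) = fun s => center γ (-s) := by
      funext s; simp [PlaneCaustic.orientedCaustic]
    rw [this]; simpa using h.reverse hper

/-- The number of normals and the index of the caustic. -/
theorem IsConvexCurve.hasWindingNumber_and_card (h : IsConvexCurve γ L)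
    (hκ : ∀ s, curvature γ s ≠ 0) {ε : ℤˣ} (hε : IsCausticOrientation γ ε) {Q : ℂ}
    (hQ : Q ∉ caustic γ) :
    ∃ k : ℤ, HasWindingNumber (orientedCaustic γ ε) L Q k ∧ (normalFeet γ Q).Finite ∧
      ((normalFeet γ Q).ncard : ℤ) = 2 * k + 2 := by
  obtain ⟨η, hη⟩ := h.exists_sign hκ
  obtain ⟨k, hk, hfin, hcard⟩ := h.card_normalFeet hκ hη hQ
  refine ⟨ε * k, hk.orientedCaustic h.periodic_center ε, hfin, ?_⟩
  -- A fold forces `ε = -η`. Without folds the condition on `ε` is vacuous, but the centre is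
  -- constant and `k = 0`.
  by_cases hfold : ∃ s, deriv (curvature γ) s ≠ 0
  · obtain ⟨s, hs⟩ := hfold
    rw [hε.unique (h.isCausticOrientation_neg hκ hη) hs, hcard]
    push_cast; ring
  · push Not at hfold
    have hconst : center γ = fun _ => center γ 0 := funext fun s =>
      is_const_of_deriv_eq_zero (fun s => (h.hasDerivAt_center hκ s).differentiableAt)
        (fun s => by rw [(h.hasDerivAt_center hκ s).deriv, hfold s]; simp) s 0
    have h0 : HasWindingNumber (center γ) L Q 0 := by
      rw [hconst]; exact hasWindingNumber_const _ _ _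
    have hk0 : k = 0 :=
      hk.unique h.pos.le (fun s _ hs => hQ ⟨s, hs⟩) h0
    rw [hcard, hk0]; simp

theorem orientedCaustic_mem (γ : ℝ → ℂ) (ε : ℤˣ) (s : ℝ) : orientedCaustic γ ε s ∈ caustic γ :=
  mem_range_self _

theorem causticIndex_eq {ε : ℤˣ} {Q : ℂ} {k : ℤ} (hL : 0 ≤ L) (hQ : Q ∉ caustic γ)
    (hk : HasWindingNumber (orientedCaustic γ ε) L Q k) : causticIndex γ L ε Q = k :=
  windingNumber_eq hL (fun s _ hs => hQ (hs ▸ orientedCaustic_mem γ ε s)) hk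

/-- The index is locally constant. -/
theorem IsConvexCurve.continuousOn_causticIndex (h : IsConvexCurve γ L)
    (hκ : ∀ s, curvature γ s ≠ 0) {ε : ℤˣ} (hε : IsCausticOrientation γ ε) :
    ContinuousOn (causticIndex γ L ε) (caustic γ)ᶜ := by
  intro Q hQ
  obtain ⟨k, hk, -⟩ := h.hasWindingNumber_and_card hκ hε hQ
  obtain ⟨r, hr, hball⟩ := Metric.isOpen_iff.1 (h.isClosed_caustic hκ).isOpen_compl Q hQ
  refine ContinuousAt.continuousWithinAt ?_
  have heq : causticIndex γ L ε =ᶠ[𝓝 Q] fun _ => k := by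
    filter_upwards [Metric.ball_mem_nhds Q hr] with Q' hQ'
    refine causticIndex_eq h.pos.le (hball hQ') (hk.of_norm_sub_lt ?_ ?_ fun s _ => ?_)
    · exact ((h.continuous_center hκ).comp (continuous_const.mul continuous_id)).continuousOn
    · rcases Int.units_eq_one_or ε with rfl | rfl
      · simpa [orientedCaustic] using h.periodic_center 0
      · simpa [orientedCaustic] using (h.periodic_center (-L)).symm
    · rw [mem_ball_iff_norm] at hQ'
      refine hQ'.trans_le (not_lt.1 fun hlt => ?_)
      exact hball (mem_ball_iff_norm.2 hlt) (orientedCaustic_mem γ ε s)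
  exact continuousAt_const.congr heq.symm

/-- A point off the caustic has at least four normals if and only if its index is not zero. -/
theorem IsConvexCurve.four_le_numNormals_iff (h : IsConvexCurve γ L)
    (hκ : ∀ s, curvature γ s ≠ 0) {ε : ℤˣ} (hε : IsCausticOrientation γ ε) {Q : ℂ}
    (hQ : Q ∉ caustic γ) : 4 ≤ numNormals γ Q ↔ causticIndex γ L ε Q ≠ 0 := by
  obtain ⟨k, hk, hfin, hcard⟩ := h.hasWindingNumber_and_card hκ hε hQ
  rw [causticIndex_eq h.pos.le hQ hk, numNormals, ← hfin.cast_ncard_eq]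
  obtain ⟨s, hs⟩ := h.exists_normalThrough Q
  -- With `n = 2k + 2` this gives `k ≥ 0`, so that `k ≠ 0` means `n ≥ 4`.
  have hpos : 0 < (normalFeet γ Q).ncard := (ncard_pos hfin).2 ⟨γ s, s, rfl, hs⟩
  rw [show (4 : ℕ∞) = ((4 : ℕ) : ℕ∞) from rfl, Nat.cast_le]
  omega

/-- The set of points of nonzero index is the union of the domains of the core. -/
theorem IsConvexCurve.biUnion_domains_eq (h : IsConvexCurve γ L)
    (hκ : ∀ s, curvature γ s ≠ 0) {ε : ℤˣ} (hε : IsCausticOrientation γ ε) :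
    ⋃ U ∈ {U | U ∈ domains γ ∧ ∀ Q ∈ U, 4 ≤ numNormals γ Q}, U =
      {Q : ℂ | Q ∉ caustic γ ∧ causticIndex γ L ε Q ≠ 0} := by
  ext Q
  constructor
  · intro hQ
    obtain ⟨U, ⟨⟨P, -, rfl⟩, hU⟩, hQU⟩ := mem_iUnion₂.1 hQ
    have hQC := connectedComponentIn_subset _ _ hQU
    exact ⟨hQC, (h.four_le_numNormals_iff hκ hε hQC).1 (hU Q hQU)⟩
  · rintro ⟨hQ, hi⟩
    refine mem_iUnion₂.2 ⟨connectedComponentIn (caustic γ)ᶜ Q, ⟨⟨Q, hQ, rfl⟩, fun P hP => ?_⟩,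
      mem_connectedComponentIn hQ⟩
    have hPC := connectedComponentIn_subset _ _ hP
    rw [h.four_le_numNormals_iff hκ hε hPC,
      isPreconnected_connectedComponentIn.constant
        ((h.continuousOn_causticIndex hκ hε).mono (connectedComponentIn_subset _ _)) hP
        (mem_connectedComponentIn hQ)]
    exact hi

end PlaneCaustic

theorem mainTheorem4 (γ : ℝ → ℂ) (L : ℝ) (hγ : PlaneCaustic.IsConvexCurve γ L)
    (hκ : ∀ s, PlaneCaustic.curvature γ s ≠ 0) :
    (∃ ε : ℤˣ, PlaneCaustic.IsCausticOrientation γ ε) ∧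
    ∀ ε : ℤˣ, PlaneCaustic.IsCausticOrientation γ ε →
      (∀ Q : ℂ, Q ∉ PlaneCaustic.caustic γ →
        (PlaneCaustic.normalFeet γ Q).Finite ∧
        ((PlaneCaustic.normalFeet γ Q).ncard : ℤ) = 2 * PlaneCaustic.causticIndex γ L ε Q + 2) ∧
      closure (PlaneCaustic.core γ) =
        closure {Q : ℂ | Q ∉ PlaneCaustic.caustic γ ∧ PlaneCaustic.causticIndex γ L ε Q ≠ 0} ∧
      ((PlaneCaustic.domains γ).Finite →
        PlaneCaustic.core γ =
          closure {Q : ℂ | Q ∉ PlaneCaustic.caustic γ ∧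
            PlaneCaustic.causticIndex γ L ε Q ≠ 0}) := by
  refine ⟨?_, fun ε hε => ⟨fun Q hQ => ?_, ?_, fun hfin => ?_⟩⟩
  · obtain ⟨η, hη⟩ := hγ.exists_sign hκ
    exact ⟨-η, hγ.isCausticOrientation_neg hκ hη⟩
  · obtain ⟨k, hk, hfin, hcard⟩ := hγ.hasWindingNumber_and_card hκ hε hQ
    exact ⟨hfin, by rw [PlaneCaustic.causticIndex_eq hγ.pos.le hQ hk, hcard]⟩
  · rw [← hγ.biUnion_domains_eq hκ hε]
    -- The core lies between the union of its open domains and the closure of that union.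
    refine subset_antisymm (closure_minimal ?_ isClosed_closure) (closure_mono ?_)
    · exact iUnion₂_subset fun U hU => closure_mono (subset_biUnion_of_mem (u := fun U => U) hU)
    · exact iUnion₂_mono fun U _ => subset_closure
  -- Closure commutes with finite unions.
  · rw [← hγ.biUnion_domains_eq hκ hε, (hfin.subset fun U hU => hU.1).closure_biUnion]
    rfl
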